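/- Let $G$ be a locally compact (Hausdorff) group with left Haar measure $m$, and let $L^1(G)$ be its group algebra, i.e. the Banach algebra of (classes of) complex-valued $m$-integrable functions on $G$ with the convolution product $(f*g)(x)=\int_G f(y)\,g(y^{-1}x)\,dm(y)$. Let $L^1_0(G)=\{f\in L^1(G):\int_G f\,dm=0\}$ be its augmentation ideal. A left ideal $I$ of a complex algebra $A$ is called finitely generated if there are $n\in\mathbb N$ and $x_1,\dots,x_n\in A$ with $I=A^\sharp x_1+\cdots+A^\sharp x_n$ (no closure is taken), where $A^\sharp=A$ if $A$ is unital and $A^\sharp$ is the unitisation $\mathbb C1\oplus A$ otherwise. Then: (a) $L^1_0(G)$ is finitely generated as a left ideal of $L^1(G)$ if and only if $G$ is finite. (b) The Dales–Żelazko conjecture holds for $L^1(G)$: if $L^1(G)$ is unital and every maximal left ideal of $L^1(G)$ is finitely generated, then $L^1(G)$ is finite-dimensional. -/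

import Mathlib

noncomputable section

open MeasureTheory Filter Topology
open scoped ENNReal Pointwise

set_option linter.unusedSectionVars false
namespace GroupAlg

section series
variable {X ι E : Type*} [MeasurableSpace X] [Countable ι] [NormedAddCommGroup E]

theorem tsum_lintegral_ne_top {m : Measure X} {F : ι → X → E}
    (hF : ∀ i, Integrable (F i) m) (hs : Summable fun i => ∫ x, ‖F i x‖ ∂m) :
    ∑' i, ∫⁻ x, ‖F i x‖ₑ ∂m ≠ ∞ := by
  have h : ∀ i, ∫⁻ x, ‖F i x‖ₑ ∂m = ENNReal.ofReal (∫ x, ‖F i x‖ ∂m) := fun i =>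
    (ofReal_integral_norm_eq_lintegral_enorm (hF i)).symm
  simp_rw [h]
  rw [← ENNReal.ofReal_tsum_of_nonneg (fun i => integral_nonneg fun x => norm_nonneg _) hs]
  exact ENNReal.ofReal_ne_top

theorem ae_summable_norm {m : Measure X} {F : ι → X → E}
    (hF : ∀ i, Integrable (F i) m) (hs : Summable fun i => ∫ x, ‖F i x‖ ∂m) :
    ∀ᵐ x ∂m, Summable fun i => ‖F i x‖ := by
  have h1 : ∫⁻ x, ∑' i, ‖F i x‖ₑ ∂m ≠ ∞ := by
    rw [lintegral_tsum fun i => (hF i).1.enorm]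
    exact tsum_lintegral_ne_top hF hs
  filter_upwards [ae_lt_top' (AEMeasurable.tsum fun i => (hF i).1.enorm) h1] with x hx
  have h2 := ENNReal.summable_toReal hx.ne
  simpa using h2

theorem integrable_of_hasSum [NormedSpace ℝ E] [CompleteSpace E] {m : Measure X}
    {F : ι → X → E} {f : X → E}
    (hF : ∀ i, Integrable (F i) m) (hs : Summable fun i => ∫ x, ‖F i x‖ ∂m)
    (hf : ∀ᵐ x ∂m, HasSum (fun i => F i x) (f x)) :
    Integrable f m ∧ HasSum (fun i => ∫ x, F i x ∂m) (∫ x, f x ∂m) := by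
  refine ⟨⟨?_, ?_⟩, ?_⟩
  · refine aestronglyMeasurable_of_tendsto_ae (u := (atTop : Filter (Finset ι)))
      (f := fun s x => ∑ i ∈ s, F i x) ?_ hf
    intro s
    exact (integrable_finsetSum s fun i _ => hF i).1
  · have h1 : ∫⁻ x, ∑' i, ‖F i x‖ₑ ∂m < ∞ := by
      rw [lintegral_tsum fun i => (hF i).1.enorm]
      exact (tsum_lintegral_ne_top hF hs).lt_top
    refine lt_of_le_of_lt (lintegral_mono_ae ?_) h1
    filter_upwards [hf, ae_summable_norm hF hs] with x hx hx'
    rw [← hx.tsum_eq]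
    have h2 : ∑' i, ‖F i x‖ₑ = ENNReal.ofReal (∑' i, ‖F i x‖) := by
      rw [ENNReal.ofReal_tsum_of_nonneg (fun i => norm_nonneg _) hx']
      simp
    rw [h2, ← ofReal_norm]
    exact ENNReal.ofReal_le_ofReal (norm_tsum_le_tsum_norm hx')
  · have h := hasSum_integral_of_summable_integral_norm hF hs
    convert h using 1
    refine integral_congr_ae ?_
    filter_upwards [hf] with x hx using hx.tsum_eq.symm

end series

variable {G : Type*} [Group G] [TopologicalSpace G] [IsTopologicalGroup G] [T2Space G]
  [LocallyCompactSpace G] [MeasurableSpace G] [BorelSpace G]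
variable {𝕜 : Type*} [RCLike 𝕜]

/-- The convolution `(f * g)(x) = ∫ f(y) g(y⁻¹x) dm(y)` of two functions on `G`. For integrable
`f` and `g` the integrand is integrable for almost every `x`, see `convolution_main`. -/
def convolution (m : Measure G) (f g : G → 𝕜) (x : G) : 𝕜 := ∫ y, f y * g (y⁻¹ * x) ∂m

/-- Continuous functions with compact support. -/
def IsCc (f : G → 𝕜) : Prop := Continuous f ∧ HasCompactSupport f

theorem IsCc.integrable {m : Measure G} [m.IsHaarMeasure] {f : G → 𝕜} (hf : IsCc f) :
    Integrable f m := hf.1.integrable_of_hasCompactSupport hf.2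

theorem IsCc.norm {f : G → 𝕜} (hf : IsCc f) : IsCc (fun x => ‖f x‖) :=
  ⟨hf.1.norm, hf.2.norm⟩

theorem IsCc.sub {f g : G → 𝕜} (hf : IsCc f) (hg : IsCc g) : IsCc (fun x => f x - g x) :=
  ⟨hf.1.sub hg.1, hf.2.sub hg.2⟩

theorem exists_isCc_integral_sub_le {m : Measure G} [m.IsHaarMeasure] [m.Regular] {f : G → 𝕜}
    (hf : Integrable f m) {ε : ℝ} (hε : 0 < ε) :
    ∃ g : G → 𝕜, IsCc g ∧ ∫ x, ‖f x - g x‖ ∂m ≤ ε := by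
  have H : ∃ g : G → 𝕜, eLpNorm (f - g) 1 m ≤ ENNReal.ofReal ε ∧ IsCc g := by
    refine (memLp_one_iff_integrable.2 hf).induction_dense ENNReal.one_ne_top IsCc ?_ ?_ ?_
      (by simpa using hε)
    · intro c t ht htμ δ hδ
      obtain ⟨η, ηpos, hη⟩ := exists_eLpNorm_indicator_le (μ := m) ENNReal.one_ne_top c hδ
      have hη2 : (η : ℝ≥0∞) / 2 ≠ 0 := by
        simpa using ηpos.ne'
      obtain ⟨s, hst, hsc, hs⟩ := ht.exists_isCompact_lt_add htμ.ne hη2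
      obtain ⟨U, hsU, hUo, hU⟩ := s.exists_isOpen_lt_add (μ := m) hsc.measure_ne_top hη2
      obtain ⟨φ, hφ1, hφ0, hφ2, hφ3⟩ := exists_continuous_one_zero_of_isCompact hsc
        hUo.isClosed_compl (Set.disjoint_compl_right_iff_subset.2 hsU)
      refine ⟨fun x => (φ x : 𝕜) * c, ?_, ?_, ?_⟩
      · have h1 : m ((U \ s) ∪ (t \ s)) ≤ η := by
          refine (measure_union_le _ _).trans ?_
          rw [measure_sdiff hsU hsc.measurableSet.nullMeasurableSet hsc.measure_ne_top,
            measure_sdiff hst hsc.measurableSet.nullMeasurableSet hsc.measure_ne_top,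
            ← ENNReal.add_halves (η : ℝ≥0∞)]
          exact add_le_add (tsub_le_iff_left.2 hU.le) (tsub_le_iff_left.2 hs.le)
        refine (eLpNorm_mono fun x => ?_).trans (hη _ h1)
        by_cases hx : x ∈ s
        · simp [hx, hφ1 hx, hst hx]
        · have hb : ‖(φ x : 𝕜)‖ ≤ 1 := by
            rw [RCLike.norm_ofReal, abs_of_nonneg (hφ3 x).1]
            exact (hφ3 x).2
          have hb2 : ‖(φ x : 𝕜) - 1‖ ≤ 1 := by
            have : (φ x : 𝕜) - 1 = ((φ x - 1 : ℝ) : 𝕜) := by simp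
            rw [this, RCLike.norm_ofReal, abs_le]
            constructor <;> linarith [(hφ3 x).1, (hφ3 x).2]
          by_cases hxU : x ∈ U <;> by_cases hxt : x ∈ t
          · have : (φ x : 𝕜) * c - c = ((φ x : 𝕜) - 1) * c := by ring
            simp only [Pi.sub_apply, Set.indicator, hxt, hxU, hx, Set.mem_union, Set.mem_sdiff, if_true, this, norm_mul, not_false_eq_true, and_self, or_self]
            exact mul_le_of_le_one_left (norm_nonneg _) hb2
          · simp only [Pi.sub_apply, Set.indicator, hxt, hxU, hx, Set.mem_union, Set.mem_sdiff, norm_mul, not_false_eq_true, and_self, if_false, if_true, sub_zero, true_or]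
            exact mul_le_of_le_one_left (norm_nonneg _) hb
          · simp [hx, hxt, hφ0 hxU]
          · simp [hxt, hφ0 hxU]
      · exact (RCLike.continuous_ofReal.comp φ.continuous).mul continuous_const
      · exact (hφ2.comp_left (g := fun r : ℝ => (r : 𝕜)) (by simp)).mul_right
    · intro f g hf hg
      exact ⟨hf.1.add hg.1, hf.2.add hg.2⟩
    · intro f hf
      exact hf.1.aestronglyMeasurable
  obtain ⟨g, h1, h2⟩ := H
  refine ⟨g, h2, ?_⟩
  have h3 := ofReal_integral_norm_eq_lintegral_enorm (hf.sub (h2.integrable (m := m)))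
  rw [eLpNorm_one_eq_lintegral_enorm, ← h3] at h1
  exact (ENNReal.ofReal_le_ofReal_iff hε.le).1 h1

theorem exists_isCc_series {m : Measure G} [m.IsHaarMeasure] [m.Regular] {f : G → 𝕜}
    (hf : Integrable f m) :
    ∃ u : ℕ → G → 𝕜, (∀ n, IsCc (u n)) ∧ (Summable fun n => ∫ x, ‖u n x‖ ∂m) ∧
      ∀ᵐ x ∂m, (Summable fun n => ‖u n x‖) ∧ HasSum (fun n => u n x) (f x) := by
  have h0 : ∀ n : ℕ, ∃ g : G → 𝕜, IsCc g ∧ ∫ x, ‖f x - g x‖ ∂m ≤ (1 / 2 : ℝ) ^ n := by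
    intro n
    exact exists_isCc_integral_sub_le hf (by positivity)
  choose w hw hwb using h0
  have hwi : ∀ n, Integrable (fun x => f x - w n x) m := fun n => hf.sub (hw n).integrable
  have hws : Summable fun n => ∫ x, ‖f x - w n x‖ ∂m :=
    Summable.of_nonneg_of_le (fun n => integral_nonneg fun x => norm_nonneg _) hwb
      summable_geometric_two
  let u : ℕ → G → 𝕜 := fun n => Nat.casesOn n (w 0) fun k x => w (k + 1) x - w k x
  have hu : ∀ n, IsCc (u n) := by
    intro n
    cases n with
    | zero => exact hw 0
    | succ k => exact (hw (k + 1)).sub (hw k)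
  have hus : Summable fun n => ∫ x, ‖u n x‖ ∂m := by
    rw [← summable_nat_add_iff 1]
    refine Summable.of_nonneg_of_le (fun n => integral_nonneg fun x => norm_nonneg _) (fun n => ?_)
      (((summable_nat_add_iff 1).2 hws).add hws)
    rw [← integral_add (hwi (n + 1)).norm (hwi n).norm]
    refine integral_mono (hu (n + 1)).integrable.norm ((hwi (n + 1)).norm.add (hwi n).norm) ?_
    intro x
    have : u (n + 1) x = (f x - w n x) - (f x - w (n + 1) x) := by
      change w (n + 1) x - w n x = _
      ring
    change ‖u (n + 1) x‖ ≤ ‖f x - w (n + 1) x‖ + ‖f x - w n x‖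
    rw [this, add_comm ‖_‖]
    exact norm_sub_le _ _
  refine ⟨u, hu, hus, ?_⟩
  filter_upwards [ae_summable_norm (fun n => (hu n).integrable) hus,
    ae_summable_norm hwi hws] with x hx hx'
  refine ⟨hx, ?_⟩
  have h1 := hx.of_norm.hasSum
  have h2 : Tendsto (fun n => w n x) atTop (𝓝 (f x)) := by
    have h3 := tendsto_zero_iff_norm_tendsto_zero.2 hx'.tendsto_atTop_zero
    simpa using h3.const_sub (f x)
  have h4 : ∀ n, ∑ i ∈ Finset.range (n + 1), u i x = w n x := by
    intro n
    induction n with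
    | zero => simp [u]
    | succ k ih =>
      rw [Finset.sum_range_succ, ih]
      change w k x + (w (k + 1) x - w k x) = _
      ring
  have h5 := (h1.tendsto_sum_nat).comp (tendsto_add_atTop_nat 1)
  have h6 : (fun n => ∑ i ∈ Finset.range n, u i x) ∘ (fun n => n + 1) = fun n => w n x :=
    funext h4
  rw [h6] at h5
  rw [tendsto_nhds_unique h2 h5]
  exact h1

theorem hasCompactSupport_kernel {u v : G → 𝕜} (hu : IsCc u) (hv : IsCc v) :
    HasCompactSupport fun p : G × G => u p.1 * v (p.1⁻¹ * p.2) := by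
  have h : HasCompactSupport fun p : G × G => u p.1 * v p.2 := by
    refine HasCompactSupport.intro (hu.2.isCompact.prod hv.2.isCompact) ?_
    rintro ⟨a, b⟩ hab
    rw [Set.mem_prod, not_and_or] at hab
    rcases hab with h | h
    · simp [image_eq_zero_of_notMem_tsupport h]
    · simp [image_eq_zero_of_notMem_tsupport h]
  exact h.comp_homeomorph (Homeomorph.shearMulRight G).symm

theorem continuous_kernel {u v : G → 𝕜} (hu : IsCc u) (hv : IsCc v) :
    Continuous fun p : G × G => u p.1 * v (p.1⁻¹ * p.2) :=
  (hu.1.comp continuous_fst).mul (hv.1.comp (continuous_fst.inv.mul continuous_snd))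

theorem integral_convolution_of_isCc {m : Measure G} [m.IsHaarMeasure] {u v : G → 𝕜}
    (hu : IsCc u) (hv : IsCc v) :
    ∫ x, convolution m u v x ∂m = (∫ x, u x ∂m) * ∫ x, v x ∂m := by
  unfold convolution
  rw [← integral_integral_swap_of_hasCompactSupport (f := fun y x => u y * v (y⁻¹ * x))
    (continuous_kernel hu hv) (hasCompactSupport_kernel hu hv)]
  simp_rw [integral_const_mul, integral_mul_left_eq_self v, integral_mul_const]

theorem integrable_slice {m : Measure G} [m.IsHaarMeasure] {u v : G → 𝕜}
    (hu : IsCc u) (hv : IsCc v) (x : G) : Integrable (fun y => u y * v (y⁻¹ * x)) m :=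
  Continuous.integrable_of_hasCompactSupport
    (hu.1.mul (hv.1.comp (continuous_id.inv.mul continuous_const))) hu.2.mul_right

theorem isCc_convolution {m : Measure G} [m.IsHaarMeasure] {u v : G → 𝕜}
    (hu : IsCc u) (hv : IsCc v) : IsCc (convolution m u v) := by
  constructor
  · rw [← continuousOn_univ]
    refine continuousOn_integral_of_compact_support (f := fun x y => u y * v (y⁻¹ * x))
      hu.2.isCompact ((continuous_kernel hu hv).comp continuous_swap).continuousOn ?_
    intro x y _ hy
    simp [image_eq_zero_of_notMem_tsupport hy]
  · refine HasCompactSupport.intro (hu.2.isCompact.mul hv.2.isCompact) ?_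
    intro x hx
    unfold convolution
    refine integral_eq_zero_of_ae (Eventually.of_forall fun y => ?_)
    by_cases hy : y ∈ tsupport u
    · have : y⁻¹ * x ∉ tsupport v := fun h => hx ⟨y, hy, _, h, by simp⟩
      simp [image_eq_zero_of_notMem_tsupport this]
    · simp [image_eq_zero_of_notMem_tsupport hy]

/-- The inverse of a compact null set is null. -/
theorem measure_inv_eq_zero {m : Measure G} [m.IsHaarMeasure] [m.Regular] {C : Set G}
    (hC : IsCompact C) (h0 : m C = 0) : m C⁻¹ = 0 := by
  obtain ⟨V, hV, hV1⟩ := exists_compact_mem_nhds (1 : G)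
  obtain ⟨u, hu1, -, hu2, hu3⟩ :=
    exists_continuous_one_zero_of_isCompact (hV.mul hC.inv) isClosed_empty (by simp)
  have huc : IsCc (fun x => u x : G → ℝ) := ⟨u.continuous, hu2⟩
  have hVpos : 0 < m.real V := by
    refine ENNReal.toReal_pos (Measure.measure_pos_of_mem_nhds m hV1).ne' hV.measure_ne_top
  have key : ∀ ε : ℝ, 0 < ε → m.real V * m.real C⁻¹ ≤ (∫ x, u x ∂m) * ε := by
    intro ε hε
    obtain ⟨U, hCU, hUo, hU⟩ := C.exists_isOpen_lt_of_lt (μ := m) (ENNReal.ofReal ε)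
      (by rw [h0]; simpa using hε)
    obtain ⟨φ, hφ1, hφ0, hφ2, hφ3⟩ := exists_continuous_one_zero_of_isCompact hC
      hUo.isClosed_compl (Set.disjoint_compl_right_iff_subset.2 hCU)
    have hφc : IsCc (fun x => φ x : G → ℝ) := ⟨φ.continuous, hφ2⟩
    have hφi : ∫ x, φ x ∂m ≤ ε := by
      have h1 : ∫ x, φ x ∂m ≤ ∫ x, U.indicator (fun _ => (1 : ℝ)) x ∂m := by
        refine integral_mono hφc.integrable
          ((integrable_indicator_iff hUo.measurableSet).2
            (integrableOn_const (hU.trans ENNReal.ofReal_lt_top).ne)) ?_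
        intro x
        by_cases hx : x ∈ U
        · simpa [hx] using (hφ3 x).2
        · simpa [hx] using (hφ0 hx).le
      refine h1.trans ?_
      rw [integral_indicator_const _ hUo.measurableSet, smul_eq_mul, mul_one]
      exact ENNReal.toReal_le_of_le_ofReal hε.le hU.le
    have h2 := integral_convolution_of_isCc (m := m) huc hφc
    have h3 : ∀ x ∈ V, m.real C⁻¹ ≤ convolution m u φ x := by
      intro x hx
      unfold convolution
      rw [← integral_mul_left_eq_self _ x]
      have hint : Integrable (fun y => u (x * y) * φ ((x * y)⁻¹ * x)) m :=
        (integrable_slice (m := m) huc hφc x).comp_mul_left x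
      have h4 : ∫ y, C⁻¹.indicator (fun _ => (1 : ℝ)) y ∂m
          ≤ ∫ y, u (x * y) * φ ((x * y)⁻¹ * x) ∂m := by
        by_cases hCm : Integrable (C⁻¹.indicator (fun _ => (1 : ℝ))) m
        · refine integral_mono hCm hint ?_
          intro y
          by_cases hy : y ∈ C⁻¹
          · have e1 : u (x * y) = 1 := hu1 (Set.mul_mem_mul hx hy)
            have e2 : φ ((x * y)⁻¹ * x) = 1 := by
              have : (x * y)⁻¹ * x = y⁻¹ := by group
              rw [this]
              exact hφ1 hy
            simp only [e1, e2]
            simp [hy]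
          · simp only [hy, not_false_eq_true, Set.indicator_of_notMem]
            exact mul_nonneg (hu3 _).1 (hφ3 _).1
        · rw [integral_undef hCm]
          exact integral_nonneg fun y => mul_nonneg (hu3 _).1 (hφ3 _).1
      refine le_trans (le_of_eq ?_) h4
      rw [integral_indicator_const _ hC.inv.measurableSet, smul_eq_mul, mul_one]
    have hci := (isCc_convolution (m := m) huc hφc).integrable (m := m)
    have h5 : ∫ x in V, m.real C⁻¹ ∂m ≤ ∫ x, convolution m u φ x ∂m := by
      refine le_trans (setIntegral_mono_on (integrableOn_const hV.measure_ne_top)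
        hci.integrableOn hV.measurableSet h3) (setIntegral_le_integral hci ?_)
      exact Eventually.of_forall fun x => integral_nonneg fun y =>
        mul_nonneg (hu3 _).1 (hφ3 _).1
    rw [setIntegral_const, smul_eq_mul, h2] at h5
    exact h5.trans (mul_le_mul_of_nonneg_left hφi (integral_nonneg fun x => (hu3 x).1))
  have h6 : m.real V * m.real C⁻¹ ≤ 0 := by
    refine ge_of_tendsto (x := 𝓝[>] (0 : ℝ)) (f := fun ε => (∫ x, u x ∂m) * ε) ?_
      (eventually_mem_nhdsWithin.mono key)
    have : Tendsto (fun ε : ℝ => (∫ x, u x ∂m) * ε) (𝓝 0) (𝓝 ((∫ x, u x ∂m) * 0)) :=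
      tendsto_id.const_mul _
    rw [mul_zero] at this
    exact this.mono_left nhdsWithin_le_nhds
  have h7 : m.real C⁻¹ = 0 := by
    have h8 : 0 ≤ m.real C⁻¹ := measureReal_nonneg
    nlinarith
  exact (measureReal_eq_zero_iff hC.inv.measure_ne_top).1 h7

theorem ae_notMem_of_null {m : Measure G} [m.IsHaarMeasure] [m.Regular] {N : Set G}
    (hN : m N = 0) {K : Set G} (hK : IsCompact K) (x : G) :
    ∀ᵐ y ∂m, y ∈ K → y⁻¹ * x ∉ N := by
  let N' := toMeasurable m N
  let S := K ∩ (fun y => y⁻¹ * x) ⁻¹' N'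
  have hcont : Continuous fun y : G => y⁻¹ * x := continuous_inv.mul continuous_const
  have hS : MeasurableSet S :=
    hK.measurableSet.inter (hcont.measurable (measurableSet_toMeasurable m N))
  have hS0 : m S = 0 := by
    by_contra h
    obtain ⟨C, hCS, hC, hC0⟩ := hS.exists_lt_isCompact_of_ne_top
      (measure_ne_top_of_subset Set.inter_subset_left hK.measure_ne_top)
      (pos_iff_ne_zero.2 h)
    have h1 : m ((fun y => y⁻¹ * x) '' C) = 0 := by
      refine measure_mono_null (t := N') ?_ (by rw [measure_toMeasurable, hN])
      rintro _ ⟨y, hy, rfl⟩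
      exact (hCS hy).2
    have h2 := measure_inv_eq_zero (hC.image hcont) h1
    have h3 : ((fun y => y⁻¹ * x) '' C)⁻¹ = x⁻¹ • C := by
      rw [← Set.image_inv_eq_inv, Set.image_image, ← Set.image_smul]
      simp
    rw [h3, measure_smul] at h2
    exact hC0.ne' h2
  filter_upwards [measure_eq_zero_iff_ae_notMem.1 hS0] with y hy hyK hyN
  exact hy ⟨hyK, subset_toMeasurable m N hyN⟩

theorem ae_eq_zero_or_good {m : Measure G} [m.IsHaarMeasure] [m.Regular] {f : G → 𝕜}
    {u : ℕ → G → 𝕜} (hu : ∀ n, IsCc (u n))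
    (huf : ∀ᵐ x ∂m, (Summable fun n => ‖u n x‖) ∧ HasSum (fun n => u n x) (f x))
    {p : G → Prop} (hp : ∀ᵐ z ∂m, p z) (x : G) :
    ∀ᵐ y ∂m, (f y = 0 ∧ ∀ n, u n y = 0) ∨ p (y⁻¹ * x) := by
  have h1 : ∀ᵐ y ∂m, ∀ n, y ∈ tsupport (u n) → y⁻¹ * x ∉ {z | ¬ p z} :=
    ae_all_iff.2 fun n => ae_notMem_of_null hp (hu n).2 x
  filter_upwards [huf, h1] with y hy hy1
  by_cases h : ∃ n, y ∈ tsupport (u n)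
  · obtain ⟨n, hn⟩ := h
    exact Or.inr (not_not.1 (hy1 n hn))
  · push Not at h
    have h3 : ∀ n, u n y = 0 := fun n => image_eq_zero_of_notMem_tsupport (h n)
    refine Or.inl ⟨?_, h3⟩
    have := hy.2
    simp only [h3] at this
    exact this.unique hasSum_zero

theorem hasSum_mul_of_norm {a b : ℕ → 𝕜} {s t : 𝕜} (ha : Summable fun n => ‖a n‖)
    (hb : Summable fun n => ‖b n‖) (hs : HasSum a s) (ht : HasSum b t) :
    HasSum (fun p : ℕ × ℕ => a p.1 * b p.2) (s * t) := by
  have h : Summable fun p : ℕ × ℕ => a p.1 * b p.2 := summable_mul_of_summable_norm ha hb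
  exact hs.mul ht h

theorem ae_hasSum_slice {m : Measure G} [m.IsHaarMeasure] [m.Regular] {f g : G → 𝕜}
    {u v : ℕ → G → 𝕜} (hu : ∀ n, IsCc (u n))
    (huf : ∀ᵐ x ∂m, (Summable fun n => ‖u n x‖) ∧ HasSum (fun n => u n x) (f x))
    (hvg : ∀ᵐ x ∂m, (Summable fun n => ‖v n x‖) ∧ HasSum (fun n => v n x) (g x)) (x : G) :
    ∀ᵐ y ∂m, HasSum (fun p : ℕ × ℕ => u p.1 y * v p.2 (y⁻¹ * x)) (f y * g (y⁻¹ * x)) := by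
  filter_upwards [huf, ae_eq_zero_or_good hu huf hvg x] with y hy hy1
  rcases hy1 with ⟨h4, h3⟩ | h2
  · simp only [h3, h4, zero_mul]
    exact hasSum_zero
  · exact hasSum_mul_of_norm (a := fun n => u n y) (b := fun n => v n (y⁻¹ * x)) hy.1 h2.1 hy.2 h2.2

/-- For integrable `f`, `g` the convolution integral converges absolutely for almost every `x`, the
convolution is integrable, and its integral is the product of the integrals. No countability
assumption on `G` is made. -/
theorem convolution_main {m : Measure G} [m.IsHaarMeasure] [m.Regular] {f g : G → 𝕜}
    (hf : Integrable f m) (hg : Integrable g m) :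
    (∀ᵐ x ∂m, Integrable (fun y => f y * g (y⁻¹ * x)) m) ∧ Integrable (convolution m f g) m ∧
      ∫ x, convolution m f g x ∂m = (∫ x, f x ∂m) * ∫ x, g x ∂m := by
  obtain ⟨u, hu, hus, huf⟩ := exists_isCc_series hf
  obtain ⟨v, hv, hvs, hvg⟩ := exists_isCc_series hg
  let F : ℕ × ℕ → G → ℝ := fun p => convolution m (fun y => ‖u p.1 y‖) (fun y => ‖v p.2 y‖)
  have hFc : ∀ p, IsCc (F p) := fun p => isCc_convolution (hu p.1).norm (hv p.2).norm
  have hF0 : ∀ p x, 0 ≤ F p x := fun p x =>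
    integral_nonneg fun y => mul_nonneg (norm_nonneg _) (norm_nonneg _)
  have hFn : ∀ p, ∫ x, ‖F p x‖ ∂m = (∫ x, ‖u p.1 x‖ ∂m) * ∫ x, ‖v p.2 x‖ ∂m := by
    intro p
    simp_rw [Real.norm_of_nonneg (hF0 p _)]
    exact integral_convolution_of_isCc (hu p.1).norm (hv p.2).norm
  have hFs : Summable fun p => ∫ x, ‖F p x‖ ∂m := by
    simp_rw [hFn]
    exact hus.mul_of_nonneg hvs (fun n => integral_nonneg fun x => norm_nonneg _)
      (fun n => integral_nonneg fun x => norm_nonneg _)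
  have key : ∀ᵐ x ∂m, Integrable (fun y => f y * g (y⁻¹ * x)) m ∧
      HasSum (fun p : ℕ × ℕ => convolution m (u p.1) (v p.2) x) (convolution m f g x) := by
    filter_upwards [ae_summable_norm (fun p => (hFc p).integrable) hFs] with x hx
    refine integrable_of_hasSum (F := fun (p : ℕ × ℕ) y => u p.1 y * v p.2 (y⁻¹ * x))
      (fun p => integrable_slice (hu p.1) (hv p.2) x) ?_ (ae_hasSum_slice hu huf hvg x)
    simp_rw [Real.norm_of_nonneg (hF0 _ x)] at hx
    simp_rw [norm_mul]
    exact hx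
  have hci : ∀ p : ℕ × ℕ, Integrable (convolution m (u p.1) (v p.2)) m := fun p =>
    (isCc_convolution (hu p.1) (hv p.2)).integrable
  have h := integrable_of_hasSum hci (Summable.of_nonneg_of_le
    (fun p => integral_nonneg fun x => norm_nonneg _) (fun p => ?_) hFs) (key.mono fun x h => h.2)
  · refine ⟨key.mono fun x h => h.1, h.1, h.2.unique ?_⟩
    simp_rw [integral_convolution_of_isCc (hu _) (hv _)]
    have hf' := (integrable_of_hasSum (fun n => (hu n).integrable) hus
      (huf.mono fun x h => h.2)).2
    have hg' := (integrable_of_hasSum (fun n => (hv n).integrable) hvs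
      (hvg.mono fun x h => h.2)).2
    refine hasSum_mul_of_norm (a := fun n => ∫ x, u n x ∂m) (b := fun n => ∫ x, v n x ∂m)
      ?_ ?_ hf' hg'
    · exact hus.of_nonneg_of_le (fun n => norm_nonneg _) fun n => norm_integral_le_integral_norm _
    · exact hvs.of_nonneg_of_le (fun n => norm_nonneg _) fun n => norm_integral_le_integral_norm _
  · refine integral_mono (hci p).norm (hFc p).integrable.norm fun x => ?_
    simp only [Real.norm_of_nonneg (hF0 p x)]
    refine (norm_integral_le_integral_norm _).trans (le_of_eq ?_)
    simp only [F, convolution, norm_mul]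

/-- The convolution depends only on the almost-everywhere classes of its arguments. -/
theorem convolution_congr {m : Measure G} [m.IsHaarMeasure] [m.Regular] {f f' g g' : G → 𝕜}
    (hf' : Integrable f' m) (hf : f =ᵐ[m] f') (hg : g =ᵐ[m] g') :
    convolution m f g = convolution m f' g' := by
  obtain ⟨u, hu, hus, huf⟩ := exists_isCc_series hf'
  funext x
  refine integral_congr_ae ?_
  filter_upwards [hf, ae_eq_zero_or_good hu huf hg x] with y h2 hy
  rcases hy with hy | hy
  · rw [h2, hy.1, zero_mul, zero_mul]
  · rw [h2, hy]

/-- The group algebra `L¹(G)`: classes of integrable complex functions with respect to the left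
Haar measure `m`, with the `L¹` norm. Its product, defined below, is convolution. -/
abbrev GroupAlgebra (m : Measure G) : Type _ := Lp ℂ 1 m

section algebra
variable {m : Measure G} [m.IsHaarMeasure] [m.Regular]

theorem integrable_convolution (f g : GroupAlgebra m) : Integrable (convolution m f g) m :=
  (convolution_main (L1.integrable_coeFn f) (L1.integrable_coeFn g)).2.1

/-- The product of `L¹(G)` is convolution, which is again integrable. -/
instance : Mul (GroupAlgebra m) := ⟨fun f g => (integrable_convolution f g).toL1⟩

theorem coeFn_mul (f g : GroupAlgebra m) : ⇑(f * g) =ᵐ[m] convolution m f g :=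
  (integrable_convolution f g).coeFn_toL1

theorem toL1_mul_toL1 {f g h : G → ℂ} (hf : Integrable f m) (hg : Integrable g m)
    (hh : Integrable h m) (e : convolution m f g = h) : hf.toL1 * hg.toL1 = hh.toL1 := by
  refine Lp.ext ((coeFn_mul _ _).trans ?_)
  rw [convolution_congr hf hf.coeFn_toL1 hg.coeFn_toL1, e]
  exact hh.coeFn_toL1.symm

theorem integral_mul' (f g : GroupAlgebra m) :
    ∫ x, (f * g) x ∂m = (∫ x, f x ∂m) * ∫ x, g x ∂m := by
  rw [integral_congr_ae (coeFn_mul f g)]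
  exact (convolution_main (L1.integrable_coeFn f) (L1.integrable_coeFn g)).2.2

theorem groupAlgebra_add_mul (f f' g : GroupAlgebra m) : (f + f') * g = f * g + f' * g := by
  refine Lp.ext ((coeFn_mul _ _).trans ?_)
  rw [convolution_congr (f' := fun y => f y + f' y) (g' := g)
    ((L1.integrable_coeFn f).add (L1.integrable_coeFn f')) (Lp.coeFn_add f f') (ae_eq_refl _)]
  filter_upwards [Lp.coeFn_add (f * g) (f' * g), coeFn_mul f g, coeFn_mul f' g,
    (convolution_main (L1.integrable_coeFn f) (L1.integrable_coeFn g)).1,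
    (convolution_main (L1.integrable_coeFn f') (L1.integrable_coeFn g)).1] with x h1 h2 h3 h4 h5
  rw [h1, Pi.add_apply, h2, h3]
  simp only [convolution, add_mul]
  exact integral_add h4 h5

theorem groupAlgebra_mul_add (f g g' : GroupAlgebra m) : f * (g + g') = f * g + f * g' := by
  refine Lp.ext ((coeFn_mul _ _).trans ?_)
  rw [convolution_congr (f' := f) (g' := fun y => g y + g' y)
    (L1.integrable_coeFn f) (ae_eq_refl _) (Lp.coeFn_add g g')]
  filter_upwards [Lp.coeFn_add (f * g) (f * g'), coeFn_mul f g, coeFn_mul f g',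
    (convolution_main (L1.integrable_coeFn f) (L1.integrable_coeFn g)).1,
    (convolution_main (L1.integrable_coeFn f) (L1.integrable_coeFn g')).1] with x h1 h2 h3 h4 h5
  rw [h1, Pi.add_apply, h2, h3]
  simp only [convolution, mul_add]
  exact integral_add h4 h5

theorem groupAlgebra_smul_mul (c : ℂ) (f g : GroupAlgebra m) : (c • f) * g = c • (f * g) := by
  refine Lp.ext ((coeFn_mul _ _).trans ?_)
  rw [convolution_congr (f' := fun y => c * f y) (g' := g)
    ((L1.integrable_coeFn f).const_mul c) (Lp.coeFn_smul c f) (ae_eq_refl _)]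
  filter_upwards [Lp.coeFn_smul c (f * g), coeFn_mul f g] with x h1 h2
  rw [h1, Pi.smul_apply, h2]
  simp only [convolution, mul_assoc, smul_eq_mul, integral_const_mul]

theorem groupAlgebra_mul_smul (c : ℂ) (f g : GroupAlgebra m) : f * (c • g) = c • (f * g) := by
  refine Lp.ext ((coeFn_mul _ _).trans ?_)
  rw [convolution_congr (f' := f) (g' := fun y => c * g y)
    (L1.integrable_coeFn f) (ae_eq_refl _) (Lp.coeFn_smul c g)]
  filter_upwards [Lp.coeFn_smul c (f * g), coeFn_mul f g] with x h1 h2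
  rw [h1, Pi.smul_apply, h2]
  simp only [convolution, mul_left_comm _ c, smul_eq_mul, integral_const_mul]

theorem groupAlgebra_norm_mul_le (f g : GroupAlgebra m) : ‖f * g‖ ≤ ‖f‖ * ‖g‖ := by
  have h := convolution_main (L1.integrable_coeFn f).norm (L1.integrable_coeFn g).norm
  simp only [L1.norm_eq_integral_norm]
  rw [← h.2.2]
  refine integral_mono_ae (L1.integrable_coeFn _).norm h.2.1 ?_
  filter_upwards [coeFn_mul f g] with x hx
  rw [hx]
  refine (norm_integral_le_integral_norm _).trans (le_of_eq ?_)
  simp only [convolution, norm_mul]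

theorem convolution_assoc_of_isCc {f g h : G → ℂ} (hf : IsCc f) (hg : IsCc g) (hh : IsCc h) :
    convolution m (convolution m f g) h = convolution m f (convolution m g h) := by
  funext x
  have h1 : Continuous (Function.uncurry fun y z => f z * g (z⁻¹ * y) * h (y⁻¹ * x)) :=
    ((continuous_kernel hf hg).comp continuous_swap).mul
      (hh.1.comp (continuous_fst.inv.mul continuous_const))
  have h2 : HasCompactSupport
      (Function.uncurry fun y z => f z * g (z⁻¹ * y) * h (y⁻¹ * x)) :=
    HasCompactSupport.mul_right
      ((hasCompactSupport_kernel hf hg).comp_homeomorph (Homeomorph.prodComm G G))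
  have h3 := integral_integral_swap_of_hasCompactSupport h1 h2 (μ := m) (ν := m)
  simp only [convolution]
  simp_rw [← integral_mul_const, ← integral_const_mul]
  rw [h3]
  refine integral_congr_ae (Eventually.of_forall fun z => ?_)
  change ∫ y, f z * g (z⁻¹ * y) * h (y⁻¹ * x) ∂m = ∫ y, f z * (g y * h (y⁻¹ * (z⁻¹ * x))) ∂m
  rw [← integral_mul_left_eq_self _ z]
  refine integral_congr_ae (Eventually.of_forall fun y => ?_)
  simp [mul_assoc]

theorem denseRange_isCc :
    DenseRange fun u : {u : G → ℂ // IsCc u} => (u.2.integrable (m := m)).toL1 u.1 := by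
  intro f
  rw [Metric.mem_closure_range_iff]
  intro ε hε
  obtain ⟨g, hg, h⟩ := exists_isCc_integral_sub_le (L1.integrable_coeFn f) (half_pos hε)
  refine ⟨⟨g, hg⟩, lt_of_le_of_lt ?_ (half_lt_self hε)⟩
  rw [dist_eq_norm, L1.norm_eq_integral_norm]
  refine le_trans (le_of_eq (integral_congr_ae ?_)) h
  filter_upwards [Lp.coeFn_sub f ((hg.integrable (m := m)).toL1 g),
    (hg.integrable (m := m)).coeFn_toL1] with x h1 h2
  simp only [h1, Pi.sub_apply, h2]

theorem continuous_groupAlgebra_mul :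
    Continuous fun p : GroupAlgebra m × GroupAlgebra m => p.1 * p.2 :=
  ((LinearMap.mk₂ ℂ (fun f g : GroupAlgebra m => f * g) groupAlgebra_add_mul
    groupAlgebra_smul_mul groupAlgebra_mul_add groupAlgebra_mul_smul).mkContinuous₂ 1
      (fun f g => by simpa using groupAlgebra_norm_mul_le f g)).continuous₂

theorem groupAlgebra_mul_assoc (f g h : GroupAlgebra m) : f * g * h = f * (g * h) := by
  have hc := continuous_groupAlgebra_mul (m := m)
  refine (denseRange_isCc (m := m)).induction_on₃ (isClosed_eq ?_ ?_) ?_ f g h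
  · exact hc.comp ((hc.comp (continuous_fst.prodMk (continuous_fst.comp continuous_snd))).prodMk
      (continuous_snd.comp continuous_snd))
  · exact hc.comp (continuous_fst.prodMk (hc.comp continuous_snd))
  · rintro ⟨u, hu⟩ ⟨v, hv⟩ ⟨w, hw⟩
    have huv := isCc_convolution (m := m) hu hv
    have hvw := isCc_convolution (m := m) hv hw
    rw [toL1_mul_toL1 hu.integrable hv.integrable huv.integrable rfl,
      toL1_mul_toL1 hv.integrable hw.integrable hvw.integrable rfl,
      toL1_mul_toL1 huv.integrable hw.integrable (isCc_convolution huv hw).integrable rfl,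
      toL1_mul_toL1 hu.integrable hvw.integrable (isCc_convolution huv hw).integrable
        (convolution_assoc_of_isCc hu hv hw).symm]

/-- `L¹(G)` is a Banach algebra under convolution. -/
instance : NonUnitalNormedRing (GroupAlgebra m) :=
  { (inferInstance : NormedAddCommGroup (Lp ℂ 1 m)) with
    mul := fun f g => f * g
    left_distrib := groupAlgebra_mul_add
    right_distrib := groupAlgebra_add_mul
    zero_mul := fun f => by simpa using groupAlgebra_smul_mul 0 f f
    mul_zero := fun f => by simpa using groupAlgebra_mul_smul 0 f f
    mul_assoc := groupAlgebra_mul_assoc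
    norm_mul_le := groupAlgebra_norm_mul_le }

instance : IsScalarTower ℂ (GroupAlgebra m) (GroupAlgebra m) := ⟨groupAlgebra_smul_mul⟩

instance : SMulCommClass ℂ (GroupAlgebra m) (GroupAlgebra m) :=
  ⟨fun c f g => (groupAlgebra_mul_smul c f g).symm⟩

end algebra

section ideals

/-- A left ideal of a (not necessarily unital) complex algebra: a linear subspace that is closed
under multiplication from the left by elements of the algebra. It need not be closed in any
topology. -/
structure LeftIdeal (A : Type*) [NonUnitalRing A] [Module ℂ A] extends Submodule ℂ A where
  mul_mem' : ∀ (a : A) {x : A}, x ∈ carrier → a * x ∈ carrier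

variable {A : Type*} [NonUnitalRing A] [Module ℂ A]

/-- Algebraic finite generation: `I = A♯ x₁ + ⋯ + A♯ xₙ`, without closure, where `A♯` is the
conditional unitisation. If `A` has no unit, then `A♯ = ℂ 1 ⊕ A`, and an element `c + a` of `A♯` acts
by `x ↦ c x + a x`. If `A` has a unit `e`, then `A♯ = A`, and the same formula describes `A♯ x`,
because `c x + a x = (c e + a) x`. -/
def LeftIdeal.IsFinitelyGenerated (I : LeftIdeal A) : Prop :=
  ∃ (n : ℕ) (x : Fin n → A), ∀ y : A, y ∈ I.toSubmodule ↔
    ∃ (c : Fin n → ℂ) (a : Fin n → A), y = ∑ i, (c i • x i + a i * x i)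

/-- A maximal left ideal: maximal among the proper left ideals. -/
def LeftIdeal.IsMaximal (I : LeftIdeal A) : Prop :=
  I.toSubmodule ≠ ⊤ ∧ ∀ J : LeftIdeal A, I.toSubmodule ≤ J.toSubmodule →
    J.toSubmodule = I.toSubmodule ∨ J.toSubmodule = ⊤

/-- The assertion of the Dales–Żelazko conjecture for the algebra `A`: if `A` is unital and each of
its maximal left ideals is finitely generated, then `A` is finite-dimensional. -/
def DalesZelazko (A : Type*) [NonUnitalRing A] [Module ℂ A] : Prop :=
  (∃ e : A, ∀ a : A, e * a = a ∧ a * e = a) →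
    (∀ I : LeftIdeal A, I.IsMaximal → I.IsFinitelyGenerated) → FiniteDimensional ℂ A

end ideals

/-- The augmentation ideal `L¹₀(G) = {f ∈ L¹(G) : ∫ f dm = 0}`. -/
def augmentationIdeal (m : Measure G) [m.IsHaarMeasure] [m.Regular] :
    LeftIdeal (GroupAlgebra m) where
  carrier := {f | ∫ x, f x ∂m = 0}
  add_mem' {f g} hf hg := by
    simp only [Set.mem_ofPred_eq] at *
    rw [integral_congr_ae (Lp.coeFn_add f g)]
    simp only [Pi.add_apply]
    rw [integral_add (L1.integrable_coeFn f) (L1.integrable_coeFn g), hf, hg, add_zero]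
  zero_mem' := by
    simp only [Set.mem_ofPred_eq]
    rw [integral_congr_ae (Lp.coeFn_zero ℂ 1 m)]
    simp
  smul_mem' c f hf := by
    simp only [Set.mem_ofPred_eq] at *
    rw [integral_congr_ae (Lp.coeFn_smul c f)]
    simp only [Pi.smul_apply]
    rw [integral_smul, hf, smul_zero]
  mul_mem' a f hf := by
    simp only [Set.mem_ofPred_eq] at *
    exact (integral_mul' a f).trans (by rw [hf, mul_zero])

end GroupAlg

end

open MeasureTheory

noncomputable section

open MeasureTheory Filter Topology
open scoped ENNReal Pointwise

set_option linter.unusedSectionVars false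

namespace GroupAlg

variable {G : Type*} [Group G] [TopologicalSpace G] [IsTopologicalGroup G] [T2Space G]
  [LocallyCompactSpace G] [MeasurableSpace G] [BorelSpace G]
  {m : Measure G} [m.IsHaarMeasure] [m.Regular]

/-! Suppose `x₁, …, xₙ` generate the augmentation ideal. Then `(c, a) ↦ ∑ (cᵢ xᵢ + aᵢ * xᵢ)` is a
continuous linear map from `ℂⁿ × L¹(G)ⁿ` onto the ideal, which is closed and hence a Banach space.
The open mapping theorem bounds the coefficients of `f` by a multiple of `‖f‖`. Dually, if `h` in
`C_c(G)` satisfies `|∫ xᵢ(s) h(ys) ds| ≤ ε` for all `i` and `y`, then `|∫ f h| ≤ C ε ‖f‖` on the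
whole ideal (`exists_norm_pairing_le_of_isFinitelyGenerated`). For `f` a difference of two
normalised indicators, this says that averages of `h` over compact sets of positive measure are
nearly equal (`exists_norm_average_sub_le_of_isFinitelyGenerated`).

Two kinds of test function contradict this unless `G` is finite. If `G` is not discrete, a bump at
`1` of tiny support pairs weakly with every translate of the `xᵢ`, by absolute continuity of the
integral, yet averages to `1` on a small set and to at most `1/2` on a fixed one. If `G` is discrete
and infinite, a tent function of the word length over a finite symmetric set `K` varies slowly under
right translation by `K`. As the `xᵢ` have integral zero and nearly all their mass on `K`, the
pairings are small, although the tent is `1` at the identity and `0` far away.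

For the converse in (a), a finite group has a finite-dimensional `L¹(G)`, where every left ideal is
finitely generated. For (b), the augmentation ideal is itself a maximal left ideal, so the
hypothesis applies to it and (a) makes `G` finite. -/

/-! ### Pairing `L¹(G)` with compactly supported continuous functions -/

theorem IsCc.exists_norm_le {h : G → ℂ} (hh : IsCc h) : ∃ M, ∀ x, ‖h x‖ ≤ M :=
  hh.1.bounded_above_of_compact_support hh.2

theorem IsCc.comp_inv {h : G → ℂ} (hh : IsCc h) : IsCc fun x => h x⁻¹ :=
  ⟨hh.1.comp continuous_inv, hh.2.comp_homeomorph (Homeomorph.inv G)⟩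

theorem IsCc.comp_mul_left {h : G → ℂ} (hh : IsCc h) (y : G) : IsCc fun x => h (y * x) :=
  ⟨hh.1.comp (continuous_const_mul y), hh.2.comp_homeomorph (Homeomorph.mulLeft y)⟩

theorem IsCc.integrable_mul {h : G → ℂ} (hh : IsCc h) {f : G → ℂ} (hf : Integrable f m) :
    Integrable (fun x => f x * h x) m := by
  obtain ⟨M, hM⟩ := hh.exists_norm_le
  exact hf.mul_bdd (c := M) hh.1.aestronglyMeasurable (Eventually.of_forall hM)

theorem norm_integral_mul_le {f h : G → ℂ} {M : ℝ} (hf : Integrable f m) (hM : ∀ x, ‖h x‖ ≤ M) :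
    ‖∫ x, f x * h x ∂m‖ ≤ M * ∫ x, ‖f x‖ ∂m := by
  rw [← integral_const_mul]
  refine norm_integral_le_of_norm_le (hf.norm.const_mul M) (Eventually.of_forall fun x => ?_)
  rw [norm_mul, mul_comm M]
  exact mul_le_mul_of_nonneg_left (hM x) (norm_nonneg _)

/-- The functional on `L¹(G)` given by integration against `h`. -/
def pairing (m : Measure G) [m.IsHaarMeasure] [m.Regular] {h : G → ℂ} (hh : IsCc h) :
    GroupAlgebra m →L[ℂ] ℂ :=
  LinearMap.mkContinuousOfExistsBound
    { toFun := fun f => ∫ x, f x * h x ∂m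
      map_add' := fun f g => by
        rw [← integral_add (hh.integrable_mul (L1.integrable_coeFn f))
          (hh.integrable_mul (L1.integrable_coeFn g))]
        refine integral_congr_ae ?_
        filter_upwards [Lp.coeFn_add f g] with x hx
        rw [hx, Pi.add_apply, add_mul]
      map_smul' := fun c f => by
        rw [RingHom.id_apply, smul_eq_mul, ← integral_const_mul]
        refine integral_congr_ae ?_
        filter_upwards [Lp.coeFn_smul c f] with x hx
        rw [hx, Pi.smul_apply, smul_eq_mul, mul_assoc] }
    (by
      obtain ⟨M, hM⟩ := hh.exists_norm_le
      refine ⟨M, fun f => ?_⟩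
      rw [L1.norm_eq_integral_norm]
      exact norm_integral_mul_le (L1.integrable_coeFn f) hM)

theorem pairing_apply {h : G → ℂ} (hh : IsCc h) (f : GroupAlgebra m) :
    pairing m hh f = ∫ x, f x * h x ∂m := rfl

theorem pairing_toL1 {f h : G → ℂ} (hh : IsCc h) (hf : Integrable f m) :
    pairing m hh hf.toL1 = ∫ x, f x * h x ∂m := by
  refine integral_congr_ae ?_
  filter_upwards [hf.coeFn_toL1] with x hx
  rw [hx]

theorem norm_pairing_le {h : G → ℂ} (hh : IsCc h) {M : ℝ} (hM : ∀ x, ‖h x‖ ≤ M)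
    (f : GroupAlgebra m) : ‖pairing m hh f‖ ≤ M * ‖f‖ := by
  rw [L1.norm_eq_integral_norm]
  exact norm_integral_mul_le (L1.integrable_coeFn f) hM

/-- With `ȟ(y) = h(y⁻¹)`, the integral of `(a * x) h` is the value at `1` of `(a * x) * ȟ = a * (x *
ȟ)`, and `(x * ȟ)(y⁻¹) = ∫ x(s) h(ys) ds`. Associativity of convolution thus replaces a separate use
of Fubini. -/
theorem norm_integral_convolution_mul_le {a x h : G → ℂ} (ha : IsCc a) (hx : IsCc x)
    (hh : IsCc h) {ε : ℝ} (hε : ∀ y, ‖∫ s, x s * h (y * s) ∂m‖ ≤ ε) :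
    ‖∫ t, convolution m a x t * h t ∂m‖ ≤ ε * ∫ t, ‖a t‖ ∂m := by
  have h1 : ∫ t, convolution m a x t * h t ∂m =
      convolution m (convolution m a x) (fun y => h y⁻¹) 1 := by
    simp [convolution]
  have h2 : convolution m a (convolution m x fun y => h y⁻¹) 1 =
      ∫ y, a y * ∫ s, x s * h (y * s) ∂m ∂m := by
    simp [convolution]
  rw [h1, convolution_assoc_of_isCc ha hx hh.comp_inv, h2]
  exact norm_integral_mul_le ha.integrable hε

theorem norm_pairing_mul_toL1_le {x h : G → ℂ} (hx : IsCc x) (hh : IsCc h) {ε : ℝ}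
    (hε : ∀ y, ‖∫ s, x s * h (y * s) ∂m‖ ≤ ε) (a : GroupAlgebra m) :
    ‖pairing m hh (a * (hx.integrable (m := m)).toL1)‖ ≤ ε * ‖a‖ := by
  refine (denseRange_isCc (m := m)).induction_on a (isClosed_le ?_ ?_) ?_
  · exact ((pairing m hh).continuous.comp
      (continuous_groupAlgebra_mul.comp (continuous_id.prodMk continuous_const))).norm
  · exact continuous_const.mul continuous_norm
  · rintro ⟨u, hu⟩
    have huc := isCc_convolution (m := m) hu hx
    rw [toL1_mul_toL1 hu.integrable hx.integrable huc.integrable rfl, pairing_toL1]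
    refine (norm_integral_convolution_mul_le hu hx hh hε).trans (le_of_eq ?_)
    rw [L1.norm_eq_integral_norm]
    congr 1
    refine integral_congr_ae ?_
    filter_upwards [(hu.integrable (m := m)).coeFn_toL1] with t ht
    rw [ht]

/-- If all left translates of `h` are almost orthogonal to `x`, then `h` is almost orthogonal to
the left ideal `L¹(G) x`. -/
theorem norm_pairing_mul_le {h : G → ℂ} (hh : IsCc h) (x : GroupAlgebra m) {ε : ℝ}
    (hε : ∀ y, ‖∫ s, x s * h (y * s) ∂m‖ ≤ ε) (a : GroupAlgebra m) :
    ‖pairing m hh (a * x)‖ ≤ ε * ‖a‖ := by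
  obtain ⟨M, hM⟩ := hh.exists_norm_le
  have hM0 : 0 ≤ M := (norm_nonneg _).trans (hM 1)
  -- Replacing `x` by some `w` in `C_c(G)` at distance less than `η` costs `M * η` in the
  -- hypothesis, since all translates of `h` share the bound `M`, and `M * (‖a‖ * η)` in the
  -- conclusion. Then `η` tends to `0`.
  have key : ∀ η : ℝ, 0 < η → ‖pairing m hh (a * x)‖ ≤ (ε + M * η) * ‖a‖ + M * (‖a‖ * η) := by
    intro η hη
    obtain ⟨⟨u, hu⟩, hxu⟩ := (denseRange_isCc (m := m)).exists_dist_lt x hη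
    set w := (hu.integrable (m := m)).toL1 u
    rw [dist_eq_norm] at hxu
    have hw : ∀ y, ‖∫ s, u s * h (y * s) ∂m‖ ≤ ε + M * η := by
      intro y
      have hy := hh.comp_mul_left y
      have e : ∫ s, u s * h (y * s) ∂m = pairing m hy x - pairing m hy (x - w) := by
        rw [← map_sub, sub_sub_cancel, pairing_toL1]
      rw [e]
      refine (norm_sub_le _ _).trans (add_le_add (hε y) ?_)
      exact (norm_pairing_le hy (fun s => hM _) _).trans
        (mul_le_mul_of_nonneg_left hxu.le hM0)
    have e : a * x = a * w + a * (x - w) := by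
      rw [← groupAlgebra_mul_add, add_sub_cancel]
    rw [e, map_add]
    refine (norm_add_le _ _).trans (add_le_add (norm_pairing_mul_toL1_le hu hh hw a) ?_)
    refine (norm_pairing_le hh hM _).trans (mul_le_mul_of_nonneg_left ?_ hM0)
    exact (groupAlgebra_norm_mul_le _ _).trans
      (mul_le_mul_of_nonneg_left hxu.le (norm_nonneg _))
  refine ge_of_tendsto (x := 𝓝[>] (0 : ℝ)) (f := fun η => (ε + M * η) * ‖a‖ + M * (‖a‖ * η)) ?_
    (eventually_mem_nhdsWithin.mono key)
  have hc : Continuous fun η : ℝ => (ε + M * η) * ‖a‖ + M * (‖a‖ * η) := by fun_prop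
  have := hc.tendsto 0
  simp only [mul_zero, add_zero] at this
  exact this.mono_left nhdsWithin_le_nhds

/-! ### The open mapping theorem on the augmentation ideal -/

theorem mem_augmentationIdeal {f : GroupAlgebra m} :
    f ∈ (augmentationIdeal m).toSubmodule ↔ ∫ x, f x ∂m = 0 := Iff.rfl

theorem isClosed_augmentationIdeal :
    IsClosed ((augmentationIdeal m).toSubmodule : Set (GroupAlgebra m)) :=
  isClosed_eq continuous_integral continuous_const

/-- By the open mapping theorem, a function that is almost orthogonal to all left translates of the
generators is almost orthogonal to the augmentation ideal, with a uniform constant. -/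
theorem exists_norm_pairing_le_of_isFinitelyGenerated
    (H : (augmentationIdeal m).IsFinitelyGenerated) :
    ∃ (n : ℕ) (x : Fin n → GroupAlgebra m) (C : ℝ), 0 < C ∧ (∀ i, ∫ s, x i s ∂m = 0) ∧
      ∀ (h : G → ℂ) (hh : IsCc h) (ε : ℝ), (∀ i y, ‖∫ s, x i s * h (y * s) ∂m‖ ≤ ε) →
        ∀ f ∈ (augmentationIdeal m).toSubmodule, 0 ≤ ε → ‖pairing m hh f‖ ≤ C * ε * ‖f‖ := by
  obtain ⟨n, x, hx⟩ := H
  set I := (augmentationIdeal m).toSubmodule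
  have : CompleteSpace I := (isClosed_augmentationIdeal (m := m)).completeSpace_coe
  let T₀ : ((Fin n → ℂ) × (Fin n → GroupAlgebra m)) →ₗ[ℂ] GroupAlgebra m :=
    { toFun := fun p => ∑ i, (p.1 i • x i + p.2 i * x i)
      map_add' := fun p q => by
        rw [← Finset.sum_add_distrib]
        refine Finset.sum_congr rfl fun i _ => ?_
        rw [Prod.fst_add, Prod.snd_add, Pi.add_apply, Pi.add_apply, add_smul,
          groupAlgebra_add_mul]
        abel
      map_smul' := fun c p => by
        rw [RingHom.id_apply, Finset.smul_sum]
        refine Finset.sum_congr rfl fun i _ => ?_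
        rw [Prod.smul_fst, Prod.smul_snd, Pi.smul_apply, Pi.smul_apply, smul_add,
          groupAlgebra_smul_mul, smul_eq_mul, mul_smul] }
  have hT₀ : Continuous T₀ := by
    change Continuous fun p : (Fin n → ℂ) × (Fin n → GroupAlgebra m) =>
      ∑ i, (p.1 i • x i + p.2 i * x i)
    refine continuous_finsetSum _ fun i _ => ?_
    refine (((continuous_apply i).comp continuous_fst).smul continuous_const).add ?_
    exact Continuous.comp (g := fun q : GroupAlgebra m × GroupAlgebra m => q.1 * q.2)
      (f := fun p : (Fin n → ℂ) × (Fin n → GroupAlgebra m) => (p.2 i, x i))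
      continuous_groupAlgebra_mul (((continuous_apply i).comp continuous_snd).prodMk continuous_const)
  have hmem : ∀ p, T₀ p ∈ I := fun p => (hx _).2 ⟨p.1, p.2, rfl⟩
  let T : ((Fin n → ℂ) × (Fin n → GroupAlgebra m)) →L[ℂ] I :=
    ContinuousLinearMap.codRestrict ⟨T₀, hT₀⟩ I hmem
  have hsurj : Function.Surjective T := by
    rintro ⟨f, hf⟩
    obtain ⟨c, a, e⟩ := (hx f).1 hf
    exact ⟨(c, a), Subtype.ext e.symm⟩
  obtain ⟨C, hC, hpre⟩ := T.exists_preimage_norm_le hsurj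
  -- Each of the `n` summands contributes a scalar term and a convolution term, both at most `ε *
  -- ‖p‖`. The extra `1` keeps the constant positive when `n = 0`.
  refine ⟨n, x, (2 * n + 1) * C, by positivity, fun i => ?_, ?_⟩
  -- The scalar part of the unitisation puts each generator in the ideal, hence its integral
  -- vanishes.
  · refine mem_augmentationIdeal.1 ((hx _).2 ⟨Pi.single i 1, 0, ?_⟩)
    rw [Finset.sum_eq_single i]
    · simp
    · intro j _ hj
      simp [hj]
    · simp
  · intro h hh ε hε f hf hε0
    obtain ⟨p, hp, hpn⟩ := hpre ⟨f, hf⟩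
    have hfp : f = ∑ i, (p.1 i • x i + p.2 i * x i) := (congrArg Subtype.val hp).symm
    have hb : ∀ i, ‖pairing m hh (p.1 i • x i + p.2 i * x i)‖ ≤ 2 * (ε * ‖p‖) := by
      intro i
      have h1 : ‖pairing m hh (p.1 i • x i)‖ ≤ ε * ‖p‖ := by
        rw [map_smul, norm_smul, mul_comm]
        -- The scalar term involves only the untranslated `h`, that is, `y = 1`.
        have := hε i 1
        simp only [one_mul] at this
        exact mul_le_mul this ((norm_le_pi_norm p.1 i).trans (norm_fst_le p)) (norm_nonneg _) hε0
      have h2 : ‖pairing m hh (p.2 i * x i)‖ ≤ ε * ‖p‖ :=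
        (norm_pairing_mul_le hh (x i) (hε i) _).trans (mul_le_mul_of_nonneg_left
          ((norm_le_pi_norm p.2 i).trans (norm_snd_le p)) hε0)
      rw [map_add]
      linarith [norm_add_le (pairing m hh (p.1 i • x i)) (pairing m hh (p.2 i * x i))]
    have hpn' : ‖p‖ ≤ C * ‖f‖ := hpn
    rw [hfp, map_sum]
    refine (norm_sum_le_of_le _ fun i _ => hb i).trans ?_
    rw [← hfp, Finset.sum_const, Finset.card_univ, Fintype.card_fin, nsmul_eq_mul]
    have h0 : 0 ≤ ε * ‖p‖ := by positivity
    have h1 : ε * ‖p‖ ≤ ε * (C * ‖f‖) := mul_le_mul_of_nonneg_left hpn' hε0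
    calc (n : ℝ) * (2 * (ε * ‖p‖)) ≤ (2 * n + 1) * (ε * ‖p‖) := by linarith
      _ ≤ (2 * n + 1) * (ε * (C * ‖f‖)) := by gcongr
      _ = _ := by ring

/-- A bound for the difference of the averages of `h` over two compact sets. -/
theorem exists_norm_average_sub_le_of_isFinitelyGenerated
    (H : (augmentationIdeal m).IsFinitelyGenerated) :
    ∃ (n : ℕ) (x : Fin n → GroupAlgebra m) (C : ℝ), 0 < C ∧ (∀ i, ∫ s, x i s ∂m = 0) ∧
      ∀ (h : G → ℂ), IsCc h → ∀ ε : ℝ, 0 ≤ ε →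
        (∀ i y, ‖∫ s, x i s * h (y * s) ∂m‖ ≤ ε) → ∀ W V : Set G, IsCompact W → IsCompact V →
        m W ≠ 0 → m V ≠ 0 → ‖⨍ s in W, h s ∂m - ⨍ s in V, h s ∂m‖ ≤ C * ε := by
  obtain ⟨n, x, C, hC, hx, hb⟩ := exists_norm_pairing_le_of_isFinitelyGenerated H
  -- The factor `2` bounds the norm of a difference of two normalised indicators. Each has integral
  -- `1`, so the difference lies in the augmentation ideal.
  refine ⟨n, x, 2 * C, by positivity, hx, fun h hh ε hε hyp W V hW hV hW0 hV0 => ?_⟩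
  have hind : ∀ K : Set G, IsCompact K → m K ≠ 0 → ∃ f : GroupAlgebra m,
      ∫ s, f s ∂m = 1 ∧ ‖f‖ = 1 ∧ pairing m hh f = ⨍ s in K, h s ∂m := by
    intro K hK hK0
    have hr : m.real K ≠ 0 := (measureReal_ne_zero_iff hK.measure_ne_top).2 hK0
    have hi : Integrable (K.indicator fun _ => ((m.real K : ℂ))⁻¹) m :=
      (integrable_indicator_iff hK.measurableSet).2 (integrableOn_const hK.measure_ne_top)
    refine ⟨hi.toL1, ?_, ?_, ?_⟩
    · rw [integral_congr_ae hi.coeFn_toL1, integral_indicator_const _ hK.measurableSet,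
        Complex.real_smul, mul_inv_cancel₀ (by exact_mod_cast hr)]
    · rw [L1.norm_of_fun_eq_integral_norm]
      simp_rw [norm_indicator_eq_indicator_norm]
      rw [integral_indicator_const _ hK.measurableSet, norm_inv, Complex.norm_real,
        Real.norm_of_nonneg measureReal_nonneg, smul_eq_mul, mul_inv_cancel₀ hr]
    · rw [pairing_toL1, setAverage_eq, Complex.real_smul, ← integral_const_mul,
        ← integral_indicator hK.measurableSet]
      refine integral_congr_ae (Eventually.of_forall fun s => ?_)
      by_cases hs : s ∈ K <;> simp [hs]
  obtain ⟨f, hf1, hf2, hf3⟩ := hind W hW hW0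
  obtain ⟨g, hg1, hg2, hg3⟩ := hind V hV hV0
  rw [← hf3, ← hg3, ← map_sub]
  have hmem : f - g ∈ (augmentationIdeal m).toSubmodule := by
    rw [mem_augmentationIdeal, integral_congr_ae (Lp.coeFn_sub f g)]
    simp only [Pi.sub_apply]
    rw [integral_sub (L1.integrable_coeFn f) (L1.integrable_coeFn g), hf1, hg1, sub_self]
  have hn : ‖f - g‖ ≤ 2 := (norm_sub_le f g).trans (by rw [hf2, hg2]; norm_num)
  calc ‖pairing m hh (f - g)‖ ≤ C * ε * ‖f - g‖ := hb h hh ε hyp _ hmem hε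
    _ ≤ C * ε * 2 := by gcongr
    _ = 2 * C * ε := by ring

/-! ### Bump functions and discreteness -/

theorem setAverage_eq_of_eqOn {h : G → ℂ} {K : Set G} (hK : IsCompact K) (hK0 : m K ≠ 0) {c : ℂ}
    (hc : ∀ s ∈ K, h s = c) : ⨍ s in K, h s ∂m = c := by
  have hr : (m.real K : ℂ) ≠ 0 := by
    exact_mod_cast (measureReal_ne_zero_iff hK.measure_ne_top).2 hK0
  rw [setAverage_eq, setIntegral_congr_fun hK.measurableSet hc, setIntegral_const,
    Complex.real_smul, Complex.real_smul, ← mul_assoc, Complex.ofReal_inv, inv_mul_cancel₀ hr,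
    one_mul]

/-- Only the part of `x` on `y⁻¹U` is seen by the translate of `h`. By left invariance this set has
the measure of `U`, so absolute continuity of the integral gives smallness uniformly in `y`. -/
theorem enorm_integral_mul_le_setLIntegral {x h : G → ℂ} {U : Set G} (hU : MeasurableSet U)
    (h1 : ∀ s, ‖h s‖ ≤ 1) (h0 : ∀ s ∉ U, h s = 0) (y : G) :
    ‖∫ s, x s * h (y * s) ∂m‖ₑ ≤ ∫⁻ s in (fun s => y * s) ⁻¹' U, ‖x s‖ₑ ∂m := by
  refine (enorm_integral_le_lintegral_enorm _).trans ?_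
  rw [← lintegral_indicator (measurable_const_mul y hU)]
  refine lintegral_mono fun s => ?_
  by_cases hs : y * s ∈ U
  · rw [Set.indicator_of_mem (show s ∈ (fun s => y * s) ⁻¹' U from hs), enorm_mul]
    refine mul_le_of_le_one_right' ?_
    rw [← ofReal_norm, ← ENNReal.ofReal_one]
    exact ENNReal.ofReal_le_ofReal (h1 _)
  · simp [h0 _ hs]

theorem norm_setAverage_le_measureReal_div {h : G → ℂ} {U V : Set G} (hU : MeasurableSet U)
    (hUm : m U ≠ ∞) (h1 : ∀ s, ‖h s‖ ≤ 1) (h0 : ∀ s ∉ U, h s = 0) :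
    ‖⨍ s in V, h s ∂m‖ ≤ m.real U / m.real V := by
  rw [setAverage_eq, norm_smul, norm_inv, Real.norm_of_nonneg measureReal_nonneg, div_eq_inv_mul]
  refine mul_le_mul_of_nonneg_left ?_ (by positivity)
  have hi : Integrable (U.indicator fun _ => (1 : ℝ)) m :=
    (integrable_indicator_iff hU).2 (integrableOn_const hUm)
  refine (norm_integral_le_of_norm_le (hi.restrict (s := V))
    (Eventually.of_forall fun s => ?_)).trans ?_
  · by_cases hs : s ∈ U
    · simpa [hs] using h1 s
    · simp [hs, h0 s hs]
  · refine (setIntegral_le_integral hi (Eventually.of_forall fun s => ?_)).trans (le_of_eq ?_)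
    · exact Set.indicator_nonneg (fun _ _ => zero_le_one) s
    · rw [integral_indicator_const _ hU, smul_eq_mul, mul_one]

/-- Bump functions supported in small open sets show that a group whose augmentation ideal is
finitely generated is discrete. -/
theorem discreteTopology_of_isFinitelyGenerated (H : (augmentationIdeal m).IsFinitelyGenerated) :
    DiscreteTopology G := by
  obtain ⟨n, x, C, hC, -, hb⟩ := exists_norm_average_sub_le_of_isFinitelyGenerated H
  by_contra hd
  rw [discreteTopology_iff_isOpen_singleton_one, isOpen_singleton_iff_punctured_nhds] at hd
  -- This makes the Haar measure of a point zero, as needed for `hpos`.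
  have : (𝓝[≠] (1 : G)).NeBot := ⟨hd⟩
  obtain ⟨V, hV, hV1⟩ := exists_compact_mem_nhds (1 : G)
  have hV0 : m V ≠ 0 := (Measure.measure_pos_of_mem_nhds m hV1).ne'
  -- With this choice the two averages may differ by at most `C * ε = 1 / 4`, whereas those
  -- constructed below differ by at least `1 / 2`.
  set ε : ℝ := 1 / (4 * C) with hε
  have hε0 : 0 < ε := by positivity
  -- Summing the generators yields one `δ` that serves all of them.
  have hfin : ∫⁻ s, ∑ i, ‖x i s‖ₑ ∂m ≠ ∞ := by
    rw [lintegral_finsetSum' _ fun i _ => (L1.integrable_coeFn (x i)).1.enorm]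
    exact ENNReal.sum_ne_top.2 fun i _ => (L1.integrable_coeFn (x i)).2.ne
  obtain ⟨δ, hδ, hδε⟩ := exists_pos_setLIntegral_lt_of_measure_lt hfin
    (ENNReal.ofReal_pos.2 hε0).ne'
  -- The bound `δ` will make the pairings small, and `m V / 2` keeps the average over `V` at most `1
  -- / 2`. Outer regularity then provides `U`.
  have hpos : m {(1 : G)} < min δ (m V / 2) := by
    rw [measure_singleton]
    exact lt_min hδ (ENNReal.half_pos hV0)
  obtain ⟨U, h1U, hUo, hU⟩ := Set.exists_isOpen_lt_of_lt {(1 : G)} _ hpos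
  obtain ⟨W, hW, hW1, hWU⟩ := exists_compact_subset hUo (h1U rfl)
  have hW0 : m W ≠ 0 :=
    (Measure.measure_pos_of_mem_nhds m (mem_interior_iff_mem_nhds.1 hW1)).ne'
  obtain ⟨φ, hφ1, hφ0, hφ2, hφ3⟩ := exists_continuous_one_zero_of_isCompact hW
    hUo.isClosed_compl (Set.disjoint_compl_right_iff_subset.2 hWU)
  set h : G → ℂ := fun s => (φ s : ℂ) with hh
  have hc : IsCc h := ⟨Complex.continuous_ofReal.comp φ.continuous,
    hφ2.comp_left (g := fun r : ℝ => (r : ℂ)) (by simp)⟩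
  have h1 : ∀ s, ‖h s‖ ≤ 1 := fun s => by
    rw [hh, Complex.norm_real, Real.norm_of_nonneg (hφ3 s).1]
    exact (hφ3 s).2
  have h0 : ∀ s ∉ U, h s = 0 := fun s hs => by simp [hh, hφ0 hs]
  have hUV : m.real U ≤ m.real V / 2 := by
    have := ENNReal.toReal_mono (ENNReal.div_ne_top hV.measure_ne_top two_ne_zero)
      (hU.le.trans (min_le_right _ _))
    rwa [ENNReal.toReal_div, ENNReal.toReal_ofNat] at this
  have hUm : m U ≠ ∞ := (hU.trans_le le_top).ne
  have hVpos : 0 < m.real V := ENNReal.toReal_pos hV0 hV.measure_ne_top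
  have key := hb h hc ε hε0.le (fun i y => ?_) W V hW hV hW0 hV0
  · rw [setAverage_eq_of_eqOn hW hW0 (c := 1) (fun s hs => by simp [hh, hφ1 hs])] at key
    have h2 := norm_setAverage_le_measureReal_div (V := V) hUo.measurableSet hUm h1 h0
    have h3 : m.real U / m.real V ≤ 1 / 2 := by
      rw [div_le_iff₀ hVpos]
      linarith
    have h4 : C * ε = 1 / 4 := by
      rw [hε]
      field_simp
    have h5 := norm_sub_norm_le (1 : ℂ) (⨍ s in V, h s ∂m)
    rw [norm_one] at h5
    linarith
  · have h2 := enorm_integral_mul_le_setLIntegral (m := m) (x := x i) hUo.measurableSet h1 h0 y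
    have h3 : m ((fun s => y * s) ⁻¹' U) < δ := by
      rw [measure_preimage_mul]
      exact hU.trans_le (min_le_left _ _)
    have h4 := (h2.trans (lintegral_mono fun s => Finset.single_le_sum
      (f := fun j => ‖x j s‖ₑ) (fun j _ => zero_le) (Finset.mem_univ i))).trans (hδε _ h3).le
    rw [← ofReal_norm] at h4
    exact (ENNReal.ofReal_le_ofReal_iff hε0.le).1 h4

/-! ### Slowly varying functions and finiteness -/

/-- The averaged indicator of the first `N` powers of `K`. -/
def powerAverage (K : Set G) (N : ℕ) (s : G) : ℝ :=
  (N : ℝ)⁻¹ * ∑ n ∈ Finset.range N, (K ^ n).indicator (fun _ => (1 : ℝ)) s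

theorem powerAverage_nonneg (K : Set G) (N : ℕ) (s : G) : 0 ≤ powerAverage K N s :=
  mul_nonneg (by positivity) (Finset.sum_nonneg fun n _ =>
    Set.indicator_nonneg (fun _ _ => zero_le_one) s)

theorem powerAverage_le_one (K : Set G) (N : ℕ) (s : G) : powerAverage K N s ≤ 1 := by
  have h : ∑ n ∈ Finset.range N, (K ^ n).indicator (fun _ => (1 : ℝ)) s ≤ N := by
    refine (Finset.sum_le_card_nsmul _ _ 1 fun n _ => ?_).trans (by simp)
    exact Set.indicator_le' (fun _ _ => le_rfl) (fun _ _ => zero_le_one) s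
  exact (mul_le_mul_of_nonneg_left h (by positivity)).trans inv_mul_le_one

/-- If `s ∈ K ^ n` then `s * t ∈ K ^ (n + 1)`, so translation by `t` shifts the sum by one index.
The shifted sum exceeds the original range only by the term of index `N`, at most `1`, which
averaging divides by `N`. When `1 ∈ K`, the function is the tent `max (0, 1 - |s| / N)`, where `|s|`
is the word length over `K` (infinite outside the powers of `K`). -/
theorem powerAverage_le_add {K : Set G} {s t : G} (ht : t ∈ K) (N : ℕ) :
    powerAverage K N s ≤ powerAverage K N (s * t) + (N : ℝ)⁻¹ := by
  have h1 : ∑ n ∈ Finset.range N, (K ^ n).indicator (fun _ => (1 : ℝ)) s ≤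
      ∑ n ∈ Finset.range N, (K ^ (n + 1)).indicator (fun _ => (1 : ℝ)) (s * t) := by
    refine Finset.sum_le_sum fun n _ => ?_
    by_cases hs : s ∈ K ^ n
    · have : s * t ∈ K ^ (n + 1) := pow_succ K n ▸ Set.mul_mem_mul hs ht
      simp [hs, this]
    · rw [Set.indicator_of_notMem hs]
      exact Set.indicator_nonneg (fun _ _ => zero_le_one) _
  have h2 := Finset.sum_range_succ' (fun n => (K ^ n).indicator (fun _ => (1 : ℝ)) (s * t)) N
  have h3 := Finset.sum_range_succ (fun n => (K ^ n).indicator (fun _ => (1 : ℝ)) (s * t)) N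
  have h4 : 0 ≤ (K ^ 0).indicator (fun _ => (1 : ℝ)) (s * t) :=
    Set.indicator_nonneg (fun _ _ => zero_le_one) _
  have h5 : (K ^ N).indicator (fun _ => (1 : ℝ)) (s * t) ≤ 1 :=
    Set.indicator_le' (fun _ _ => le_rfl) (fun _ _ => zero_le_one) _
  unfold powerAverage
  rw [← mul_add_one]
  exact mul_le_mul_of_nonneg_left (by linarith) (by positivity)

theorem abs_powerAverage_sub_le {K : Set G} {s t : G} (ht : t ∈ K) (ht' : t⁻¹ ∈ K) (N : ℕ) :
    |powerAverage K N (s * t) - powerAverage K N s| ≤ (N : ℝ)⁻¹ := by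
  have h1 := powerAverage_le_add (s := s) ht N
  have h2 := powerAverage_le_add (s := s * t) ht' N
  rw [mul_inv_cancel_right] at h2
  rw [abs_le]
  constructor <;> linarith

theorem powerAverage_eq_zero {K : Set G} (hK : (1 : G) ∈ K) {N : ℕ} {s : G} (hs : s ∉ K ^ N) :
    powerAverage K N s = 0 := by
  unfold powerAverage
  rw [Finset.sum_eq_zero, mul_zero]
  intro n hn
  refine Set.indicator_of_notMem (fun h => hs ?_) _
  exact Set.pow_subset_pow_right hK (Finset.mem_range.1 hn).le h

theorem powerAverage_one {K : Set G} (hK : (1 : G) ∈ K) {N : ℕ} (hN : N ≠ 0) :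
    powerAverage K N 1 = 1 := by
  unfold powerAverage
  have h : ∀ n ∈ Finset.range N, (K ^ n).indicator (fun _ => (1 : ℝ)) (1 : G) = 1 := fun n _ =>
    Set.indicator_of_mem (Set.one_mem_pow hK) _
  rw [Finset.sum_congr rfl h]
  simp [hN]

/-- An integrable function of integral zero, concentrated up to `η` on the set `K`, is almost
orthogonal to functions that vary by at most `δ` under translation by elements of `K`. -/
theorem norm_integral_mul_le_of_slowly_varying {x u h : G → ℂ} {δ η : ℝ} {K : Set G}
    (hx : Integrable x m) (hx0 : ∫ s, x s ∂m = 0) (hu : Integrable u m)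
    (huK : ∀ s ∉ K, u s = 0) (hxu : ∫ s, ‖x s - u s‖ ∂m ≤ η) (hh : IsCc h)
    (y : G) (h1 : ∀ s, ‖h (y * s) - h y‖ ≤ 1) (hδ : 0 ≤ δ)
    (hK : ∀ s ∈ K, ‖h (y * s) - h y‖ ≤ δ) :
    ‖∫ s, x s * h (y * s) ∂m‖ ≤ δ * ∫ s, ‖x s‖ ∂m + η := by
  -- Since `x` has integral zero, the constant `h y` can be subtracted, so only the variation of `h`
  -- matters.
  have e : ∫ s, x s * h (y * s) ∂m = ∫ s, x s * (h (y * s) - h y) ∂m := by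
    simp_rw [mul_sub]
    rw [integral_sub ((hh.comp_mul_left y).integrable_mul hx) (hx.mul_const _),
      integral_mul_const, hx0, zero_mul, sub_zero]
  rw [e]
  have hi := (hx.norm.const_mul δ).add (g := fun s => ‖x s - u s‖) (hx.sub hu).norm
  refine (norm_integral_le_of_norm_le hi (Eventually.of_forall fun s => ?_)).trans ?_
  · rw [norm_mul]
    change _ ≤ δ * ‖x s‖ + ‖x s - u s‖
    by_cases hs : s ∈ K
    · rw [mul_comm]
      exact (mul_le_mul_of_nonneg_right (hK s hs) (norm_nonneg _)).trans
        (le_add_of_nonneg_right (norm_nonneg _))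
    -- Off `K` the function `u` vanishes, so `‖x s‖` is already the approximation error and the
    -- crude bound `1` on the variation suffices.
    · rw [huK s hs, sub_zero]
      exact (mul_le_of_le_one_right (norm_nonneg _) (h1 s)).trans
        (le_add_of_nonneg_left (by positivity))
  · change ∫ s, (δ * ‖x s‖ + ‖x s - u s‖) ∂m ≤ _
    rw [integral_add (g := fun s => ‖x s - u s‖) (hx.norm.const_mul δ) (hx.sub hu).norm, integral_const_mul]
    linarith

theorem finite_of_isFinitelyGenerated (H : (augmentationIdeal m).IsFinitelyGenerated) :
    Finite G := by
  have hd := discreteTopology_of_isFinitelyGenerated H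
  obtain ⟨n, x, C, hC, hx0, hb⟩ := exists_norm_average_sub_le_of_isFinitelyGenerated H
  by_contra hfin
  rw [not_finite_iff_infinite] at hfin
  set ε : ℝ := 1 / (4 * C) with hε
  have hε0 : 0 < ε := by positivity
  choose u hu hxu using fun i =>
    exists_isCc_integral_sub_le (L1.integrable_coeFn (x i)) hε0
  have hL : ∀ i, (tsupport (u i)).Finite := fun i => (hu i).2.isCompact.finite_of_discrete
  -- In a discrete group compact supports are finite. Adding `1` and then all inverses gives a
  -- finite symmetric `K` with nested powers, outside which every `u i` vanishes.
  set L : Set G := {1} ∪ ⋃ i, tsupport (u i)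
  have hLf : L.Finite := (Set.finite_singleton 1).union (Set.finite_iUnion hL)
  set K : Set G := L ∪ L⁻¹
  have hKf : K.Finite := hLf.union hLf.inv
  have h1K : (1 : G) ∈ K := Or.inl (Or.inl rfl)
  have hKinv : ∀ s ∈ K, s⁻¹ ∈ K := by
    rintro s (hs | hs)
    · exact Or.inr (by simpa using hs)
    · exact Or.inl hs
  -- This `N` is large enough that a variation of `1 / N` along `K`, integrated against any
  -- generator, costs at most `ε`.
  obtain ⟨N, hN⟩ := exists_nat_gt ((∑ i, ∫ s, ‖x i s‖ ∂m) / ε)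
  have hS : ∀ i, ∫ s, ‖x i s‖ ∂m ≤ ∑ j, ∫ s, ‖x j s‖ ∂m := fun i =>
    Finset.single_le_sum (f := fun j => ∫ s, ‖x j s‖ ∂m)
      (fun j _ => integral_nonneg fun s => norm_nonneg _) (Finset.mem_univ i)
  have hNpos : (0 : ℝ) < N := lt_of_le_of_lt (div_nonneg (Finset.sum_nonneg fun j _ =>
    integral_nonneg fun s => norm_nonneg _) hε0.le) hN
  have hN0 : N ≠ 0 := by
    rintro rfl
    simp at hNpos
  have hKN : (K ^ N).Finite := by
    clear hN hNpos hN0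
    induction N with
    | zero => simp
    | succ k ih => exact pow_succ K k ▸ ih.mul hKf
  -- Infiniteness of `G` enters only here; `K` need not generate `G`.
  obtain ⟨g, hg⟩ := hKN.exists_notMem
  set h : G → ℂ := fun s => (powerAverage K N s : ℂ) with hh
  have hc : IsCc h := by
    refine ⟨continuous_of_discreteTopology, HasCompactSupport.intro hKN.isCompact ?_⟩
    intro s hs
    simp [hh, powerAverage_eq_zero h1K hs]
  have hdiff : ∀ y s, ‖h (y * s) - h y‖ = |powerAverage K N (y * s) - powerAverage K N y| := by
    intro y s
    rw [hh, ← Complex.ofReal_sub, Complex.norm_real, Real.norm_eq_abs]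
  have hsing : ∀ s : G, m {s} ≠ 0 := fun s =>
    (isOpen_discrete {s}).measure_ne_zero m (Set.singleton_nonempty s)
  -- One `ε` comes from the slow variation along `K`, the other from approximating `x i` by `u i`.
  -- Averages over singletons are point values, so the conclusion reads `1 ≤ C * (2 * ε) = 1 / 2`.
  have key := hb h hc (2 * ε) (by positivity) (fun i y => ?_) {1} {g} isCompact_singleton
    isCompact_singleton (hsing 1) (hsing g)
  · rw [setAverage_eq_of_eqOn isCompact_singleton (hsing 1) (c := 1),
      setAverage_eq_of_eqOn isCompact_singleton (hsing g) (c := 0)] at key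
    · have h4 : C * (2 * ε) = 1 / 2 := by
        rw [hε]
        field_simp
        norm_num
      rw [h4, sub_zero, norm_one] at key
      norm_num at key
    · rintro s rfl
      simp [hh, powerAverage_eq_zero h1K hg]
    · rintro s rfl
      simp [hh, powerAverage_one h1K hN0]
  · have h2 := norm_integral_mul_le_of_slowly_varying (K := K) (δ := (N : ℝ)⁻¹)
      (L1.integrable_coeFn (x i)) (hx0 i) ((hu i).integrable (m := m)) ?_ (hxu i) hc y ?_
      (by positivity) ?_
    · have h3 : (N : ℝ)⁻¹ * ∫ s, ‖x i s‖ ∂m ≤ ε := by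
        rw [inv_mul_le_iff₀ hNpos]
        rw [div_lt_iff₀ hε0] at hN
        linarith [hS i]
      linarith
    · intro s hs
      refine image_eq_zero_of_notMem_tsupport fun h => hs ?_
      exact Or.inl (Or.inr (Set.mem_iUnion.2 ⟨i, h⟩))
    · intro s
      rw [hdiff, abs_le]
      constructor <;> linarith [powerAverage_nonneg K N (y * s), powerAverage_nonneg K N y,
        powerAverage_le_one K N (y * s), powerAverage_le_one K N y]
    · intro s hs
      rw [hdiff]
      exact abs_powerAverage_sub_le hs (hKinv s hs) N

/-! ### Finite groups, and maximality of the augmentation ideal -/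

/-- A finite Hausdorff group is discrete, so every point has positive Haar measure and
almost-everywhere equality is equality. Hence `L¹(G)` embeds linearly in `G → ℂ`. -/
theorem finiteDimensional_groupAlgebra [Finite G] {μ : Measure G} [μ.IsHaarMeasure] :
    FiniteDimensional ℂ (GroupAlgebra μ) := by
  have hsing : ∀ s : G, μ {s} ≠ 0 := fun s =>
    (isOpen_discrete {s}).measure_ne_zero μ (Set.singleton_nonempty s)
  have hae : ∀ {f g : G → ℂ}, f =ᵐ[μ] g → f = g := fun {f g} h => by
    funext s
    by_contra hs
    exact hsing s (measure_mono_null (Set.singleton_subset_iff.2 hs) h)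
  let T : GroupAlgebra μ →ₗ[ℂ] (G → ℂ) :=
    { toFun := fun f => f
      map_add' := fun f g => hae (Lp.coeFn_add f g)
      map_smul' := fun c f => hae (Lp.coeFn_smul c f) }
  refine FiniteDimensional.of_injective T fun f g h => ?_
  exact Lp.ext (Eventually.of_forall fun s => congrFun h s)

theorem LeftIdeal.isFinitelyGenerated_of_finiteDimensional {A : Type*} [NonUnitalRing A]
    [Module ℂ A] [FiniteDimensional ℂ A] (I : LeftIdeal A) : I.IsFinitelyGenerated := by
  obtain ⟨n, x, hx⟩ := Submodule.fg_iff_exists_fin_generating_family.1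
    (IsNoetherian.noetherian I.toSubmodule)
  have hxI : ∀ i, x i ∈ I.toSubmodule := fun i => hx ▸ Submodule.subset_span ⟨i, rfl⟩
  refine ⟨n, x, fun y => ⟨fun hy => ?_, ?_⟩⟩
  · rw [← hx, Submodule.mem_span_range_iff_exists_fun] at hy
    obtain ⟨c, rfl⟩ := hy
    exact ⟨c, 0, by simp⟩
  · rintro ⟨c, a, rfl⟩
    exact Submodule.sum_mem _ fun i _ => Submodule.add_mem _ (Submodule.smul_mem _ _ (hxI i))
      (I.mul_mem' (a i) (hxI i))

/-- As the kernel of a nonzero linear functional it has codimension one, so it is maximal even among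
proper subspaces. -/
theorem augmentationIdeal_isMaximal : (augmentationIdeal m).IsMaximal := by
  obtain ⟨V, hV, hV1⟩ := exists_compact_mem_nhds (1 : G)
  have hr : m.real V ≠ 0 := (measureReal_ne_zero_iff hV.measure_ne_top).2
    (Measure.measure_pos_of_mem_nhds m hV1).ne'
  constructor
  · intro h
    have hi : Integrable (V.indicator fun _ => (1 : ℂ)) m :=
      (integrable_indicator_iff hV.measurableSet).2 (integrableOn_const hV.measure_ne_top)
    have h1 : hi.toL1 ∈ (augmentationIdeal m).toSubmodule := h ▸ Submodule.mem_top
    rw [mem_augmentationIdeal, integral_congr_ae hi.coeFn_toL1,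
      integral_indicator_const _ hV.measurableSet] at h1
    simp [hr] at h1
  · intro J hJ
    by_cases hle : J.toSubmodule ≤ (augmentationIdeal m).toSubmodule
    · exact Or.inl (le_antisymm hle hJ)
    · obtain ⟨g, hgJ, hg⟩ := SetLike.not_le_iff_exists.1 hle
      rw [mem_augmentationIdeal] at hg
      refine Or.inr (eq_top_iff.2 fun f _ => ?_)
      -- This scalar makes the integral of `f - c • g` vanish, which writes `f` as an element of the
      -- ideal plus a multiple of `g`.
      set c : ℂ := (∫ s, f s ∂m) / ∫ s, g s ∂m
      have h1 : f - c • g ∈ (augmentationIdeal m).toSubmodule := by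
        rw [mem_augmentationIdeal]
        have h2 : ⇑(f - c • g) =ᵐ[m] fun s => f s - c * g s := by
          filter_upwards [Lp.coeFn_sub f (c • g), Lp.coeFn_smul c g] with s h3 h4
          rw [h3, Pi.sub_apply, h4, Pi.smul_apply, smul_eq_mul]
        rw [integral_congr_ae h2, integral_sub (L1.integrable_coeFn f)
          ((L1.integrable_coeFn g).const_mul c), integral_const_mul, div_mul_cancel₀ _ hg,
          sub_self]
      have h5 := J.toSubmodule.add_mem (hJ h1) (J.toSubmodule.smul_mem c hgJ)
      rwa [sub_add_cancel] at h5

end GroupAlg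

end

theorem corollary1p4 {G : Type*} [Group G] [TopologicalSpace G] [IsTopologicalGroup G] [T2Space G]
    [LocallyCompactSpace G] [MeasurableSpace G] [BorelSpace G]
    (m : Measure G) [m.IsHaarMeasure] [m.Regular] :
    ((GroupAlg.augmentationIdeal m).IsFinitelyGenerated ↔ Finite G) ∧
      GroupAlg.DalesZelazko (GroupAlg.GroupAlgebra m) := by
  have hfd : Finite G → FiniteDimensional ℂ (GroupAlg.GroupAlgebra m) := fun _ =>
    GroupAlg.finiteDimensional_groupAlgebra
  refine ⟨⟨GroupAlg.finite_of_isFinitelyGenerated, fun hG => ?_⟩, fun _ hmax => ?_⟩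
  · have := hfd hG
    exact GroupAlg.LeftIdeal.isFinitelyGenerated_of_finiteDimensional _
  · exact hfd (GroupAlg.finite_of_isFinitelyGenerated
      (hmax _ GroupAlg.augmentationIdeal_isMaximal))
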